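/- Let $\mu$ be a probability measure on $\mathbb{R}$ with density $\frac{d\mu}{dx}(x) = e^{-v(x)}$, where $v:\mathbb{R}\to\mathbb{R}$ is twice continuously differentiable and, for a given $\varepsilon>0$, $v''(x)\ge \varepsilon$ for all $x\in\mathbb{R}$. Suppose that $\mu$ has mean zero, $\int x\,d\mu(x)=0$, and let $\gamma$ be the standard Gaussian measure on $\mathbb{R}$. Then, with the absolute constant $c = 1-\log 2 > 0$, $$ \Big(\tfrac12 + c\,\min\{1,\sqrt{\varepsilon}\}\Big)\, W_2^2(\mu,\gamma) \;\le\; D(\mu|\gamma), $$ where $W_2(\mu,\gamma) = \inf_\pi \big(\iint |x-z|^2\,d\pi(x,z)\big)^{1/2}$, the infimum running over all probability measures $\pi$ on $\mathbb{R}\times\mathbb{R}$ with marginals $\mu$ and $\gamma$, and $D(\mu|\gamma) = \int \log\frac{d\mu}{d\gamma}\,d\mu$ is the relative entropy. -/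

import Mathlib

open MeasureTheory ProbabilityTheory InformationTheory

open scoped ENNReal

/-- `π` has first marginal `μ` and second marginal `ν`. When `μ` is a probability measure,
`π` is then automatically one as well. -/
def IsCoupling {E : Type*} [MeasurableSpace E] (π : Measure (E × E)) (μ ν : Measure E) : Prop :=
  π.map Prod.fst = μ ∧ π.map Prod.snd = ν

/-- The quadratic Kantorovich distance
`W₂(μ, ν) = inf_π (∫∫ |x - z|² dπ(x, z))^{1/2}`, the infimum running over all couplings `π`
of `μ` and `ν`, with values in `[0, ∞]`. -/
noncomputable def W2 {E : Type*} [MeasurableSpace E] [PseudoEMetricSpace E]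
    (μ ν : Measure E) : ℝ≥0∞ :=
  ⨅ (π : Measure (E × E)) (_ : IsCoupling π μ ν),
    (∫⁻ p, edist p.1 p.2 ^ 2 ∂π) ^ (1 / 2 : ℝ)

open Filter Topology

/-! Let `T` be the increasing map pushing γ to μ, φ the Gaussian density and k = T − id. The change
of variables T' = φ / e^{−v∘T} turns the entropy into ∫ ((T² − x²)/2 − log T') dγ. Since (T² − x²)/2
= k²/2 + xk and ∫ xk dγ = ∫ k' dγ, the entropy equals ½∫ k² dγ + ∫ (T' − 1 − log T') dγ. Dropping
the last, nonnegative term gives Talagrand's inequality; here it is kept. Convexity of v yields T' ≤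
1/√ε (Caffarelli's contraction, `sqrt_mul_gaussianPDFReal_le`). On that range s − 1 − log s ≥ c
min(1, √ε)(s − 1)² (`one_sub_log_two_mul_min_mul_sq_le`). Both means vanish, so ∫ k dγ = 0 and the
Poincaré inequality gives ∫ (T' − 1)² dγ ≥ ∫ k² dγ, which supplies the extra constant. -/

/-- On `(0, 2]` the function `s - 1 - log s` dominates `(1 - log 2) (s - 1)²`. -/
lemma one_sub_log_two_mul_sq_le {s : ℝ} (h0 : 0 < s) (h2 : s ≤ 2) :
    (1 - Real.log 2) * (s - 1) ^ 2 ≤ s - 1 - Real.log s := by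
  set c := 1 - Real.log 2 with hc
  have l1 := Real.log_two_gt_d9
  have l2 := Real.log_two_lt_d9
  have hc1 : 0.3 < c := by rw [hc]; linarith
  have hc2 : c < 0.4 := by rw [hc]; linarith
  -- The constant c makes `h` vanish at 2 as well as at 1. Its derivative changes sign only at 1 and
  -- at 1/(2c), which lies in (1, 2), so `h` falls to 0 at 1, rises, then falls to 0 at 2.
  let h : ℝ → ℝ := fun s => s - 1 - Real.log s - c * (s - 1) ^ 2
  have hd : ∀ x, 0 < x → HasDerivAt h ((x - 1) * (1 / x - 2 * c)) x := by
    intro x hx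
    have := (((hasDerivAt_id x).sub_const 1).sub (Real.hasDerivAt_log hx.ne')).sub
      ((((hasDerivAt_id x).sub_const 1).pow 2).const_mul c)
    refine this.congr_deriv ?_
    simp only [id, Nat.add_one_sub_one, pow_one, Nat.cast_ofNat]
    field_simp
  have hcont : ∀ S : Set ℝ, (∀ x ∈ S, 0 < x) → ContinuousOn h S := fun S hS x hx =>
    (hd x (hS x hx)).continuousAt.continuousWithinAt
  have hval1 : h 1 = 0 := by simp [h]
  have hval2 : h 2 = 0 := by simp only [h, hc]; ring
  suffices 0 ≤ h s by simp only [h] at this; linarith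
  have hc1' : 1 < 1 / (2 * c) := by rw [lt_div_iff₀ (by linarith)]; linarith
  have hc2' : 1 / (2 * c) < 2 := by rw [div_lt_iff₀ (by linarith)]; linarith
  rcases le_total s 1 with hs | hs
  · have : AntitoneOn h (Set.Ioc 0 1) := by
      refine antitoneOn_of_deriv_nonpos (convex_Ioc 0 1) (hcont _ fun x hx => hx.1) ?_ ?_
      · intro x hx
        rw [interior_Ioc] at hx
        exact (hd x hx.1).differentiableAt.differentiableWithinAt
      · intro x hx
        rw [interior_Ioc] at hx
        rw [(hd x hx.1).deriv]
        have : 1 ≤ 1 / x := by rw [le_div_iff₀ hx.1]; linarith [hx.2]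
        exact mul_nonpos_of_nonpos_of_nonneg (by linarith [hx.2]) (by linarith)
    have := this ⟨h0, hs⟩ ⟨one_pos, le_rfl⟩ hs
    linarith
  · rcases le_total s (1 / (2 * c)) with hs' | hs'
    · have : MonotoneOn h (Set.Icc 1 (1 / (2 * c))) := by
        refine monotoneOn_of_deriv_nonneg (convex_Icc _ _)
          (hcont _ fun x hx => by linarith [hx.1]) ?_ ?_
        · intro x hx
          rw [interior_Icc] at hx
          exact (hd x (by linarith [hx.1])).differentiableAt.differentiableWithinAt
        · intro x hx
          rw [interior_Icc] at hx
          have hx0 : 0 < x := by linarith [hx.1]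
          rw [(hd x hx0).deriv]
          have : 2 * c ≤ 1 / x := by
            rw [le_div_iff₀ hx0]
            have := hx.2
            rw [lt_div_iff₀ (by linarith)] at this
            linarith
          exact mul_nonneg (by linarith [hx.1]) (by linarith)
      have := this ⟨le_rfl, hc1'.le⟩ ⟨hs, hs'⟩ hs
      linarith
    · have : AntitoneOn h (Set.Icc (1 / (2 * c)) 2) := by
        refine antitoneOn_of_deriv_nonpos (convex_Icc _ _)
          (hcont _ fun x hx => by linarith [hx.1]) ?_ ?_
        · intro x hx
          rw [interior_Icc] at hx
          exact (hd x (by linarith [hx.1])).differentiableAt.differentiableWithinAt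
        · intro x hx
          rw [interior_Icc] at hx
          have hx0 : 0 < x := by linarith [hx.1]
          rw [(hd x hx0).deriv]
          have : 1 / x ≤ 2 * c := by
            rw [div_le_iff₀ hx0]
            have := hx.1
            rw [div_lt_iff₀ (by linarith)] at this
            linarith
          exact mul_nonpos_of_nonneg_of_nonpos (by linarith [hx.1]) (by linarith)
      have := this ⟨hs', h2⟩ ⟨hc2'.le, le_rfl⟩ h2
      linarith

/-- The tangent to log at 2 bounds the right side below by s/2 − log 2, which exceeds the left side
by (s − 2)(log 2 − 1/2). -/
lemma one_sub_log_two_mul_le {s : ℝ} (h2 : 2 ≤ s) :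
    (1 - Real.log 2) * (s - 1) ≤ s - 1 - Real.log s := by
  have l1 := Real.log_two_gt_d9
  have h := Real.log_le_sub_one_of_pos (show 0 < s / 2 by linarith)
  rw [Real.log_div (by linarith) (by norm_num)] at h
  nlinarith

/-- Quadratic lower bound for `s - 1 - log s` on `(0, 1 / r]`. -/
lemma one_sub_log_two_mul_min_mul_sq_le {s r : ℝ} (h0 : 0 < s) (hsr : r * s ≤ 1) :
    (1 - Real.log 2) * min 1 r * (s - 1) ^ 2 ≤ s - 1 - Real.log s := by
  have l2 := Real.log_two_lt_d9
  rcases le_total s 2 with h2 | h2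
  · refine le_trans ?_ (one_sub_log_two_mul_sq_le h0 h2)
    have : (1 - Real.log 2) * min 1 r ≤ (1 - Real.log 2) * 1 :=
      mul_le_mul_of_nonneg_left (min_le_left _ _) (by linarith)
    nlinarith [sq_nonneg (s - 1)]
  · refine le_trans ?_ (one_sub_log_two_mul_le h2)
    -- The cap r s ≤ 1 absorbs one factor s − 1, reducing the quadratic bound to the linear one.
    have h3 : min 1 r * (s - 1) ≤ 1 := by
      rcases le_total r 0 with hr | hr
      · have : min 1 r ≤ 0 := (min_le_right _ _).trans hr
        nlinarith
      · have : min 1 r * (s - 1) ≤ r * (s - 1) :=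
          mul_le_mul_of_nonneg_right (min_le_right _ _) (by linarith)
        nlinarith
    calc (1 - Real.log 2) * min 1 r * (s - 1) ^ 2
        = (1 - Real.log 2) * (s - 1) * (min 1 r * (s - 1)) := by ring
      _ ≤ (1 - Real.log 2) * (s - 1) * 1 :=
          mul_le_mul_of_nonneg_left h3 (mul_nonneg (by linarith) (by linarith))
      _ = _ := by ring

/-! ### Gaussian integration by parts and Poincaré inequality. -/

lemma hasDerivAt_gaussianPDFReal_zero_one (x : ℝ) :
    HasDerivAt (gaussianPDFReal 0 1) (-x * gaussianPDFReal 0 1 x) x := by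
  have h : HasDerivAt (fun y : ℝ => -(y - 0) ^ 2 / (2 * ((1 : NNReal) : ℝ))) (-x) x := by
    have := ((((hasDerivAt_id x).sub_const 0).pow 2).neg).div_const (2 * ((1 : NNReal) : ℝ))
    refine this.congr_deriv ?_
    simp only [id, sub_zero, Nat.add_one_sub_one, pow_one, NNReal.coe_one, Nat.cast_ofNat]
    ring
  rw [gaussianPDFReal_def]
  refine (h.exp.const_mul _).congr_deriv ?_
  ring

lemma integrable_gaussianReal_iff {g : ℝ → ℝ} :
    Integrable g (gaussianReal 0 1) ↔ Integrable (fun x => gaussianPDFReal 0 1 x * g x) := by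
  rw [gaussianReal_of_var_ne_zero _ one_ne_zero,
    integrable_withDensity_iff_integrable_smul' (measurable_gaussianPDF _ _)
      (ae_of_all _ fun _ => gaussianPDF_lt_top)]
  simp [toReal_gaussianPDF]

/-- Gaussian integration by parts. -/
lemma integral_deriv_sub_mul_gaussianReal {g g' : ℝ → ℝ} (hg : ∀ x, HasDerivAt g (g' x) x)
    (hint : Integrable g (gaussianReal 0 1))
    (hint' : Integrable (fun x => g' x - x * g x) (gaussianReal 0 1)) :
    ∫ x, (g' x - x * g x) ∂(gaussianReal 0 1) = 0 := by
  rw [integral_gaussianReal_eq_integral_smul one_ne_zero]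
  rw [integrable_gaussianReal_iff] at hint hint'
  -- As φ' = −xφ, the integrand times φ is (φg)'; integrability of φg replaces any decay condition
  -- at infinity.
  refine integral_eq_zero_of_hasDerivAt_of_integrable (fun x => ?_) hint' hint
  refine ((hasDerivAt_gaussianPDFReal_zero_one x).mul (hg x)).congr_deriv ?_
  ring

lemma integrable_gaussianReal_of_abs_le {g : ℝ → ℝ} (hg : Continuous g) (A B : ℝ)
    (h : ∀ x, |g x| ≤ A + B * x ^ 2) : Integrable g (gaussianReal 0 1) := by
  have h2 : Integrable (fun x : ℝ => x ^ 2) (gaussianReal 0 1) := by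
    have := (memLp_id_gaussianReal (μ := 0) (v := 1) 2).integrable_sq
    simpa using this
  refine ((integrable_const A).add (h2.const_mul B)).mono' hg.aestronglyMeasurable ?_
  exact ae_of_all _ fun x => by simpa using h x

lemma abs_sub_le_mul_abs_of_abs_deriv_le {k k' : ℝ → ℝ} (hk : ∀ x, HasDerivAt k (k' x) x) {L : ℝ}
    (hL : ∀ x, |k' x| ≤ L) (x y : ℝ) : |k x - k y| ≤ L * |x - y| :=
  Convex.norm_image_sub_le_of_norm_hasDerivWithin_le (s := Set.univ)
    (fun z _ => (hk z).hasDerivWithinAt) (fun z _ => hL z) convex_univ trivial trivial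

/-- A weighted Hardy inequality for the Gaussian measure. -/
lemma integral_sq_le_integral_deriv_sq_of_zero {k k' : ℝ → ℝ} (hk : ∀ x, HasDerivAt k (k' x) x)
    (hk' : Continuous k') {L : ℝ} (hL : ∀ x, |k' x| ≤ L) (h0 : k 0 = 0) :
    ∫ x, k x ^ 2 ∂(gaussianReal 0 1) ≤ ∫ x, k' x ^ 2 ∂(gaussianReal 0 1) := by
  have hkd : Differentiable ℝ k := fun x => (hk x).differentiableAt
  -- `w` is k/x, extended by k'(0). Integration by parts applied to x w² = k²/x gives the identity ∫
  -- k² = ∫ k'² − ∫ (k' − w)².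
  set w := dslope k 0 with hw
  have hwk : ∀ x, k x = x * w x := fun x => by
    have := sub_smul_dslope k 0 x
    simpa [h0, eq_comm] using this
  have hwc : Continuous w := by
    rw [continuous_iff_continuousAt]
    intro x
    rcases eq_or_ne x 0 with rfl | hx
    · exact continuousAt_dslope_same.2 (hkd 0)
    · exact (continuousAt_dslope_of_ne hx).2 (hkd x).continuousAt
  have hw0 : w 0 = k' 0 := by rw [hw, dslope_same, (hk 0).deriv]
  have hwL : ∀ x, |w x| ≤ L := by
    intro x
    rcases eq_or_ne x 0 with rfl | hx
    · rw [hw0]; exact hL 0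
    · have := abs_sub_le_mul_abs_of_abs_deriv_le hk hL x 0
      rw [h0, sub_zero, sub_zero, hwk, abs_mul, mul_comm] at this
      exact le_of_mul_le_mul_right this (abs_pos.2 hx)
  have hw2 : ∀ x, w x ^ 2 ≤ L ^ 2 := fun x => sq_le_sq' (abs_le.1 (hwL x)).1 (abs_le.1 (hwL x)).2
  have hk2 : ∀ x, k' x ^ 2 ≤ L ^ 2 := fun x => sq_le_sq' (abs_le.1 (hL x)).1 (abs_le.1 (hL x)).2
  have hder : ∀ x, HasDerivAt (fun x => x * w x ^ 2)
      (k' x ^ 2 - (k' x - w x) ^ 2) x := by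
    intro x
    rcases eq_or_ne x 0 with rfl | hx
    · rw [hw0, sub_self, hasDerivAt_iff_tendsto_slope]
      have h1 : Tendsto (fun x => w x ^ 2) (𝓝[≠] 0) (𝓝 (w 0 ^ 2)) :=
        ((hwc.pow 2).tendsto 0).mono_left nhdsWithin_le_nhds
      rw [hw0] at h1
      simp only [ne_eq, OfNat.ofNat_ne_zero, not_false_eq_true, zero_pow, sub_zero]
      refine h1.congr' ?_
      filter_upwards [self_mem_nhdsWithin] with y hy
      have hy : y ≠ 0 := hy
      rw [slope_def_field]
      field_simp
      ring
    · have h1 : HasDerivAt (fun y => k y ^ 2 / y) (k' x ^ 2 - (k' x - w x) ^ 2) x := by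
        refine (((hk x).pow 2).div (hasDerivAt_id x) hx).congr_deriv ?_
        simp only [Pi.pow_apply, hwk x, id]
        field_simp
        ring
      refine h1.congr_of_eventuallyEq ?_
      filter_upwards [isOpen_ne.mem_nhds hx] with y hy
      have hy : y ≠ 0 := hy
      rw [hwk y]
      field_simp
  have i1 : Integrable (fun x => k x ^ 2) (gaussianReal 0 1) := by
    refine integrable_gaussianReal_of_abs_le (hkd.continuous.pow 2) 0 (L ^ 2) fun x => ?_
    rw [abs_of_nonneg (sq_nonneg _), hwk]
    nlinarith [hw2 x, sq_nonneg x]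
  have i2 : Integrable (fun x => k' x ^ 2) (gaussianReal 0 1) := by
    refine integrable_gaussianReal_of_abs_le (hk'.pow 2) (L ^ 2) 0 fun x => ?_
    rw [abs_of_nonneg (sq_nonneg _)]
    linarith [hk2 x]
  have i3 : Integrable (fun x => (k' x - w x) ^ 2) (gaussianReal 0 1) := by
    refine integrable_gaussianReal_of_abs_le ((hk'.sub hwc).pow 2) (4 * L ^ 2) 0 fun x => ?_
    rw [abs_of_nonneg (sq_nonneg _)]
    nlinarith [hk2 x, hw2 x, sq_nonneg (k' x + w x)]
  have i4 : Integrable (fun x => x * w x ^ 2) (gaussianReal 0 1) := by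
    refine integrable_gaussianReal_of_abs_le (continuous_id.mul (hwc.pow 2)) (L ^ 2) (L ^ 2)
      fun x => ?_
    rw [abs_mul, abs_of_nonneg (sq_nonneg (w x))]
    have hx : |x| ≤ 1 + x ^ 2 := by
      rw [abs_le]; constructor <;> nlinarith [sq_nonneg (x + 1), sq_nonneg (x - 1)]
    nlinarith [mul_le_mul hx (hw2 x) (sq_nonneg _) (by positivity)]
  have heq : (fun x => k' x ^ 2 - (k' x - w x) ^ 2 - x * (x * w x ^ 2)) =
      fun x => k' x ^ 2 - (k' x - w x) ^ 2 - k x ^ 2 := by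
    funext x; rw [hwk x]; ring
  have i23 : Integrable (fun x => k' x ^ 2 - (k' x - w x) ^ 2) (gaussianReal 0 1) := i2.sub i3
  have key := integral_deriv_sub_mul_gaussianReal hder i4
    (by rw [heq]; exact i23.sub i1)
  rw [heq, integral_sub i23 i1, integral_sub i2 i3] at key
  have : 0 ≤ ∫ x, (k' x - w x) ^ 2 ∂(gaussianReal 0 1) := integral_nonneg fun x => sq_nonneg _
  linarith

/-- The Gaussian Poincaré inequality for centered Lipschitz functions. -/
lemma integral_sq_le_integral_deriv_sq_gaussianReal {k k' : ℝ → ℝ}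
    (hk : ∀ x, HasDerivAt k (k' x) x) (hk' : Continuous k') {L : ℝ} (hL : ∀ x, |k' x| ≤ L)
    (h0 : ∫ x, k x ∂(gaussianReal 0 1) = 0) (i1 : Integrable k (gaussianReal 0 1))
    (i2 : Integrable (fun x => k x ^ 2) (gaussianReal 0 1)) :
    ∫ x, k x ^ 2 ∂(gaussianReal 0 1) ≤ ∫ x, k' x ^ 2 ∂(gaussianReal 0 1) := by
  -- For centered k, subtracting k(0) only increases the second moment, by k(0)².
  refine le_trans ?_ (integral_sq_le_integral_deriv_sq_of_zero (k := fun x => k x - k 0)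
    (fun x => (hk x).sub_const _) hk' hL (sub_self _))
  have heq : (fun x => (k x - k 0) ^ 2) = fun x => k x ^ 2 - 2 * k 0 * k x + k 0 ^ 2 := by
    funext x; ring
  have i3 : Integrable (fun x => k x ^ 2 - 2 * k 0 * k x) (gaussianReal 0 1) :=
    i2.sub (i1.const_mul _)
  rw [heq, integral_add i3 (integrable_const _), integral_sub i2 (i1.const_mul _), integral_const_mul, h0]
  simp
  positivity

/-! ### Monotone rearrangement on the line. -/

section Transport

lemma cdf_mem_Ioo_of_strictMono {μ : Measure ℝ} (h : StrictMono (cdf μ)) (x : ℝ) :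
    cdf μ x ∈ Set.Ioo (0 : ℝ) 1 :=
  ⟨(cdf_nonneg μ (x - 1)).trans_lt (h (by linarith)),
    (h (show x < x + 1 by linarith)).trans_le (cdf_le_one μ _)⟩

lemma exists_cdf_eq {μ : Measure ℝ} (h : Continuous (cdf μ)) {p : ℝ} (hp : p ∈ Set.Ioo (0 : ℝ) 1) :
    ∃ y, cdf μ y = p :=
  mem_range_of_exists_le_of_exists_ge h
    (((tendsto_cdf_atBot μ).eventually (ge_mem_nhds hp.1)).exists)
    (((tendsto_cdf_atTop μ).eventually (le_mem_nhds hp.2)).exists)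

variable {μ ν : Measure ℝ} [IsProbabilityMeasure μ] [IsProbabilityMeasure ν] {f g : ℝ → ℝ}

lemma hasDerivAt_cdf_of_withDensity (hf : Continuous f) (hf0 : ∀ x, 0 < f x)
    (hμ : μ = volume.withDensity (fun x => ENNReal.ofReal (f x))) (x : ℝ) :
    HasDerivAt (cdf μ) (f x) x := by
  have hsub : ∀ y, cdf μ y = cdf μ 0 + ∫ t in (0 : ℝ)..y, f t := by
    have hIoc : ∀ a b : ℝ, a ≤ b → cdf μ b - cdf μ a = ∫ t in a..b, f t := by
      intro a b hab
      have h1 : μ (Set.Ioc a b) = ENNReal.ofReal (cdf μ b - cdf μ a) := by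
        conv_lhs => rw [← measure_cdf μ]
        exact StieltjesFunction.measure_Ioc _ _ _
      have h2 : μ (Set.Ioc a b) = ENNReal.ofReal (∫ t in a..b, f t) := by
        conv_lhs => rw [hμ]
        rw [withDensity_apply _ measurableSet_Ioc, intervalIntegral.integral_of_le hab,
          ofReal_integral_eq_lintegral_ofReal]
        · exact (hf.integrableOn_Icc).mono_set Set.Ioc_subset_Icc_self
        · exact ae_of_all _ fun t => (hf0 t).le
      rw [h1, ENNReal.ofReal_eq_ofReal_iff (sub_nonneg.2 (monotone_cdf μ hab))
        (intervalIntegral.integral_nonneg hab fun t _ => (hf0 t).le)] at h2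
      exact h2
    intro y
    rcases le_total 0 y with h | h
    · rw [← hIoc 0 y h]; ring
    · rw [intervalIntegral.integral_symm, ← hIoc y 0 h]; ring
  have : (cdf μ : ℝ → ℝ) = fun y => cdf μ 0 + ∫ t in (0 : ℝ)..y, f t := funext hsub
  rw [this]
  exact (hf.integral_hasStrictDerivAt 0 x).hasDerivAt.const_add _

lemma strictMono_cdf_of_withDensity (hf : Continuous f) (hf0 : ∀ x, 0 < f x)
    (hμ : μ = volume.withDensity (fun x => ENNReal.ofReal (f x))) : StrictMono (cdf μ) :=
  strictMono_of_deriv_pos fun x => by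
    rw [(hasDerivAt_cdf_of_withDensity hf hf0 hμ x).deriv]; exact hf0 x

/-- The increasing transport map between two probability measures with continuous positive
densities. -/
lemma exists_monotone_transport (hf : Continuous f) (hf0 : ∀ x, 0 < f x)
    (hμ : μ = volume.withDensity (fun x => ENNReal.ofReal (f x)))
    (hg : Continuous g) (hg0 : ∀ x, 0 < g x)
    (hν : ν = volume.withDensity (fun x => ENNReal.ofReal (g x))) :
    ∃ T : ℝ → ℝ, (∀ x, HasDerivAt T (g x / f (T x)) x) ∧ ν.map T = μ ∧
      Tendsto T atTop atTop ∧ Tendsto T atBot atBot := by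
  have hFd := hasDerivAt_cdf_of_withDensity hf hf0 hμ
  have hGd := hasDerivAt_cdf_of_withDensity hg hg0 hν
  have hFm := strictMono_cdf_of_withDensity hf hf0 hμ
  have hGm := strictMono_cdf_of_withDensity hg hg0 hν
  have hFc : Continuous (cdf μ) := continuous_iff_continuousAt.2 fun x => (hFd x).continuousAt
  have hGc : Continuous (cdf ν) := continuous_iff_continuousAt.2 fun x => (hGd x).continuousAt
  have hF01 := cdf_mem_Ioo_of_strictMono hFm
  have hG01 := cdf_mem_Ioo_of_strictMono hGm
  -- The quantile function of μ; its arbitrary values outside (0, 1) are never met, since both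
  -- distribution functions stay strictly inside. The transport is `q` composed with `cdf ν`.
  set q : ℝ → ℝ := Function.invFun (cdf μ)
  have hqF : ∀ y, q (cdf μ y) = y := Function.leftInverse_invFun hFm.injective
  have hFq : ∀ p ∈ Set.Ioo (0 : ℝ) 1, cdf μ (q p) = p := fun p hp =>
    Function.invFun_eq (exists_cdf_eq hFc hp)
  have hqm : StrictMonoOn q (Set.Ioo 0 1) := by
    intro a ha b hb hab
    rw [← hFm.lt_iff_lt, hFq a ha, hFq b hb]
    exact hab
  have hqd : ∀ p ∈ Set.Ioo (0 : ℝ) 1, HasDerivAt q (f (q p))⁻¹ p := by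
    intro p hp
    have hnhds : Set.Ioo (0 : ℝ) 1 ∈ 𝓝 p := isOpen_Ioo.mem_nhds hp
    refine HasDerivAt.of_local_left_inverse ?_ (hFd (q p)) (hf0 _).ne' ?_
    · refine hqm.continuousAt_of_image_mem_nhds hnhds ?_
      convert univ_mem
      exact Set.eq_univ_of_forall fun y => ⟨_, hF01 y, hqF y⟩
    · filter_upwards [hnhds] with r hr using hFq r hr
  have hFT : ∀ x, cdf μ (q (cdf ν x)) = cdf ν x := fun x => hFq _ (hG01 x)
  have hTd : ∀ x, HasDerivAt (fun x => q (cdf ν x)) (g x / f (q (cdf ν x))) x := fun x =>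
    ((hqd _ (hG01 x)).comp x (hGd x)).congr_deriv (by rw [div_eq_mul_inv, mul_comm])
  have hTm : Monotone (fun x => q (cdf ν x)) := fun x y hxy =>
    hqm.monotoneOn (hG01 x) (hG01 y) (hGm.monotone hxy)
  have hTs : ∀ y, ∃ x, q (cdf ν x) = y := fun y => by
    obtain ⟨x, hx⟩ := exists_cdf_eq hGc (hF01 y)
    exact ⟨x, by rw [hx, hqF]⟩
  refine ⟨fun x => q (cdf ν x), hTd, ?_, ?_, ?_⟩
  · have hmeas : Measurable (fun x => q (cdf ν x)) := hTm.measurable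
    have : IsProbabilityMeasure (ν.map fun x => q (cdf ν x)) :=
      Measure.isProbabilityMeasure_map hmeas.aemeasurable
    refine Measure.ext_of_Iic _ _ fun y => ?_
    rw [Measure.map_apply hmeas measurableSet_Iic]
    obtain ⟨x, hx⟩ := exists_cdf_eq hGc (hF01 y)
    have : (fun x => q (cdf ν x)) ⁻¹' Set.Iic y = Set.Iic x := by
      ext z
      simp only [Set.mem_preimage, Set.mem_Iic]
      rw [← hFm.le_iff_le, hFT, ← hx, hGm.le_iff_le]
    rw [this, ← ofReal_cdf, ← ofReal_cdf, hx]
  · exact tendsto_atTop_atTop_of_monotone hTm fun b => (hTs b).imp fun _ h => h.ge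
  · exact tendsto_atBot_atBot_of_monotone hTm fun b => (hTs b).imp fun _ h => h.le

end Transport

/-! ### Caffarelli's contraction in dimension one. -/

section Contraction

variable {v : ℝ → ℝ} {ε : ℝ}

/-- Subtracting the linear and quadratic terms from v leaves a convex function with zero slope at 0,
hence minimal there. -/
lemma quadratic_le_of_le_deriv_deriv (hv : ContDiff ℝ 2 v)
    (hconv : ∀ x : ℝ, ε ≤ deriv (deriv v) x) (x : ℝ) :
    v 0 + deriv v 0 * x + ε / 2 * x ^ 2 ≤ v x := by
  have hv1 : ∀ x, HasDerivAt v (deriv v x) x := fun x =>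
    (hv.differentiable two_ne_zero x).hasDerivAt
  have hv2 : ∀ x, HasDerivAt (deriv v) (deriv (deriv v) x) x := fun x =>
    ((hv.differentiable_deriv_two) x).hasDerivAt
  set u : ℝ → ℝ := fun x => v x - deriv v 0 * x - ε / 2 * x ^ 2 with hu
  have hu1 : ∀ x, HasDerivAt u (deriv v x - deriv v 0 - ε * x) x := fun x => by
    refine (((hv1 x).sub ((hasDerivAt_id x).const_mul (deriv v 0))).sub
      (((hasDerivAt_id x).pow 2).const_mul (ε / 2))).congr_deriv ?_
    simp
    ring
  have hmono : Monotone (fun x => deriv v x - deriv v 0 - ε * x) := by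
    have hd : ∀ x, HasDerivAt (fun x => deriv v x - deriv v 0 - ε * x)
        (deriv (deriv v) x - ε) x := fun x => by
      refine (((hv2 x).sub_const _).sub ((hasDerivAt_id x).const_mul ε)).congr_deriv ?_
      simp
    exact monotone_of_hasDerivAt_nonneg hd fun x => sub_nonneg.2 (hconv x)
  have hmin : u 0 ≤ u x := by
    rcases le_total 0 x with hx | hx
    · refine monotoneOn_of_deriv_nonneg (convex_Ici 0)
        (fun y _ => (hu1 y).continuousAt.continuousWithinAt)
        (fun y _ => (hu1 y).differentiableAt.differentiableWithinAt) (fun y hy => ?_)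
        (Set.mem_Ici.2 le_rfl) (Set.mem_Ici.2 hx) hx
      rw [interior_Ici] at hy
      rw [(hu1 y).deriv]
      have := hmono (le_of_lt hy)
      simpa using this
    · refine antitoneOn_of_deriv_nonpos (convex_Iic 0)
        (fun y _ => (hu1 y).continuousAt.continuousWithinAt)
        (fun y _ => (hu1 y).differentiableAt.differentiableWithinAt) (fun y hy => ?_)
        (Set.mem_Iic.2 hx) (Set.mem_Iic.2 le_rfl) hx
      rw [interior_Iic] at hy
      rw [(hu1 y).deriv]
      have := hmono (le_of_lt hy)
      simpa using this
  simp only [hu] at hmin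
  linarith

lemma tendsto_exp_neg_cocompact_of_le_deriv_deriv (hv : ContDiff ℝ 2 v) (hε : 0 < ε)
    (hconv : ∀ x : ℝ, ε ≤ deriv (deriv v) x) :
    Tendsto (fun x => Real.exp (-v x)) (cocompact ℝ) (𝓝 0) := by
  refine Real.tendsto_exp_neg_atTop_nhds_zero.comp ?_
  -- Half of the quadratic term is spent completing the square to absorb the linear one.
  have hlow : ∀ x, v 0 - (deriv v 0) ^ 2 / ε + ε / 4 * ‖x‖ ^ 2 ≤ v x := fun x => by
    refine le_trans ?_ (quadratic_le_of_le_deriv_deriv hv hconv x)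
    rw [Real.norm_eq_abs, sq_abs]
    have : 0 ≤ (deriv v 0 + ε / 2 * x) ^ 2 / ε := by positivity
    have h2 : (deriv v 0 + ε / 2 * x) ^ 2 / ε =
      (deriv v 0) ^ 2 / ε + deriv v 0 * x + ε / 4 * x ^ 2 := by field_simp; ring
    linarith
  refine tendsto_atTop_mono hlow (tendsto_atTop_add_const_left _ _ ?_)
  exact ((tendsto_pow_atTop two_ne_zero).comp (tendsto_norm_cocompact_atTop (E := ℝ))).const_mul_atTop
    (by positivity)

lemma tendsto_gaussianPDFReal_cocompact :
    Tendsto (gaussianPDFReal 0 1) (cocompact ℝ) (𝓝 0) := by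
  have h := tendsto_rpow_abs_mul_exp_neg_mul_sq_cocompact (a := 1 / 2) (by norm_num) 0
  have := h.const_mul (√(2 * Real.pi * (1 : NNReal)))⁻¹
  rw [mul_zero] at this
  refine this.congr fun x => ?_
  simp [gaussianPDFReal]
  left
  ring

/-- The increasing map transporting the standard Gaussian measure to a measure with density
`exp (-v)`, `v'' ≥ ε`, is `1 / √ε`-Lipschitz. -/
lemma sqrt_mul_gaussianPDFReal_le (hv : ContDiff ℝ 2 v) (hε : 0 < ε)
    (hconv : ∀ x : ℝ, ε ≤ deriv (deriv v) x) {T : ℝ → ℝ}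
    (hT : ∀ x, HasDerivAt T (gaussianPDFReal 0 1 x / Real.exp (-v (T x))) x)
    (htop : Tendsto T atTop atTop) (hbot : Tendsto T atBot atBot) (x : ℝ) :
    √ε * gaussianPDFReal 0 1 x ≤ Real.exp (-v (T x)) := by
  have hv1 : ∀ x, HasDerivAt v (deriv v x) x := fun x =>
    (hv.differentiable two_ne_zero x).hasDerivAt
  have hv2 : ∀ x, HasDerivAt (deriv v) (deriv (deriv v) x) x := fun x =>
    ((hv.differentiable_deriv_two) x).hasDerivAt
  have hφ : ∀ x, 0 < gaussianPDFReal 0 1 x := fun x => gaussianPDFReal_pos 0 1 x one_ne_zero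
  have hTco : Tendsto T (cocompact ℝ) (cocompact ℝ) := by
    rw [cocompact_eq_atBot_atTop]
    exact hbot.sup_sup htop
  -- Minimum principle for g = e^{−v∘T}(1 − √ε T'). It vanishes at infinity, so a negative value
  -- would force a negative global minimum z. The transport equation gives g' = φ·(√ε x − v'(T x)),
  -- so the bracket vanishes at z.
  set g : ℝ → ℝ := fun x => Real.exp (-v (T x)) - √ε * gaussianPDFReal 0 1 x with hg
  have hgd : ∀ x, HasDerivAt g (gaussianPDFReal 0 1 x * (√ε * x - deriv v (T x))) x := by
    intro x
    have h1 := ((hv1 (T x)).comp x (hT x)).neg.exp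
    refine (h1.sub ((hasDerivAt_gaussianPDFReal_zero_one x).const_mul (√ε))).congr_deriv ?_
    have := (Real.exp_pos (-v (T x))).ne'
    simp only [Pi.neg_apply, Function.comp_apply]
    field_simp
    ring
  have hkd : ∀ x, HasDerivAt (fun x => √ε * x - deriv v (T x))
      (√ε - deriv (deriv v) (T x) * (gaussianPDFReal 0 1 x / Real.exp (-v (T x)))) x := by
    intro x
    refine (((hasDerivAt_id x).const_mul (√ε)).sub ((hv2 (T x)).comp x (hT x))).congr_deriv ?_
    simp
  have hgc : Continuous g := continuous_iff_continuousAt.2 fun x => (hgd x).continuousAt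
  have hglim : Tendsto g (cocompact ℝ) (𝓝 0) := by
    have := ((tendsto_exp_neg_cocompact_of_le_deriv_deriv hv hε hconv).comp hTco).sub
      (tendsto_gaussianPDFReal_cocompact.const_mul (√ε))
    simpa [hg] using this
  by_contra! hneg
  have hgx : g x < 0 := sub_neg.2 hneg
  obtain ⟨z, hz⟩ := hgc.exists_forall_le' x
    ((hglim.eventually (lt_mem_nhds hgx)).mono fun y hy => hy.le)
  have hgz : g z < 0 := (hz x).trans_lt hgx
  have hcrit : √ε * z - deriv v (T z) = 0 := by
    have h1 : IsLocalMin g z := Eventually.of_forall hz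
    have := h1.hasDerivAt_eq_zero (hgd z)
    exact (mul_eq_zero.1 this).resolve_left (hφ z).ne'
  -- g(z) < 0 means √ε T'(z) > 1, whence v''(T z) T'(z) ≥ ε T'(z) > √ε. The bracket is then negative
  -- just right of z and g drops below its minimum.
  have hslope : √ε - deriv (deriv v) (T z) * (gaussianPDFReal 0 1 z / Real.exp (-v (T z))) < 0 := by
    have hs : 0 < √ε := Real.sqrt_pos.2 hε
    have hss : √ε * √ε = ε := Real.mul_self_sqrt hε.le
    have hlt : 1 < √ε * (gaussianPDFReal 0 1 z / Real.exp (-v (T z))) := by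
      rw [← mul_div_assoc, one_lt_div (Real.exp_pos _)]
      exact sub_neg.1 hgz
    have hnn : 0 ≤ gaussianPDFReal 0 1 z / Real.exp (-v (T z)) :=
      div_nonneg (hφ z).le (Real.exp_pos _).le
    have := mul_le_mul_of_nonneg_right (hconv (T z)) hnn
    rw [← hss] at this
    nlinarith
  have hev : ∀ᶠ y in 𝓝[>] z, √ε * y - deriv v (T y) < 0 := by
    have h1 := (hasDerivAt_iff_tendsto_slope.1 (hkd z)).eventually (gt_mem_nhds hslope)
    have h2 := h1.filter_mono (nhdsWithin_mono z (fun y (hy : z < y) => hy.ne'))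
    filter_upwards [h2, self_mem_nhdsWithin] with y hy hzy
    have hzy : z < y := hzy
    rw [slope_def_field, hcrit, sub_zero, div_neg_iff] at hy
    rcases hy with hy | hy
    · linarith [hy.2]
    · exact hy.1
  obtain ⟨b, hb, hIoo⟩ := mem_nhdsGT_iff_exists_Ioo_subset.1 hev
  have hanti : StrictAntiOn g (Set.Icc z ((z + b) / 2)) := by
    have hb : z < b := hb
    refine strictAntiOn_of_deriv_neg (convex_Icc _ _) hgc.continuousOn fun y hy => ?_
    rw [interior_Icc] at hy
    rw [(hgd y).deriv]
    exact mul_neg_of_pos_of_neg (hφ y) (hIoo ⟨hy.1, by linarith [hy.2]⟩)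
  have hb : z < b := hb
  have := hanti (Set.left_mem_Icc.2 (by linarith)) (Set.right_mem_Icc.2 (by linarith))
    (by linarith)
  exact absurd (hz ((z + b) / 2)) (not_le.2 this)

end Contraction

/-! ### Cost and entropy along the transport map. -/

/-- The graph of T is one competitor in the infimum; its optimality is not needed. -/
lemma W2_sq_le_lintegral_of_map_eq {E : Type*} [MeasurableSpace E] [PseudoEMetricSpace E]
    [OpensMeasurableSpace E] [SecondCountableTopology E]
    {μ ν : Measure E} {T : E → E} (hT : Measurable T) (hmap : ν.map T = μ) :
    W2 μ ν ^ 2 ≤ ∫⁻ x, edist (T x) x ^ 2 ∂ν := by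
  have hm : Measurable fun x => (T x, x) := hT.prodMk measurable_id
  have hc : IsCoupling (ν.map fun x => (T x, x)) μ ν := by
    constructor
    · rw [Measure.map_map measurable_fst hm]; exact hmap
    · rw [Measure.map_map measurable_snd hm]; exact Measure.map_id
  have hle : W2 μ ν ≤ (∫⁻ x, edist (T x) x ^ 2 ∂ν) ^ (1 / 2 : ℝ) := by
    unfold W2
    refine (iInf₂_le (ν.map fun x => (T x, x)) hc).trans_eq ?_
    rw [lintegral_map (by fun_prop) hm]
  calc W2 μ ν ^ 2 ≤ ((∫⁻ x, edist (T x) x ^ 2 ∂ν) ^ (1 / 2 : ℝ)) ^ 2 := by gcongr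
    _ = _ := by
      rw [← ENNReal.rpow_natCast, ← ENNReal.rpow_mul]
      norm_num

lemma llr_withDensity_gaussianReal {μ : Measure ℝ} {v : ℝ → ℝ} (hv : Continuous v)
    (hμ : μ = volume.withDensity (fun x => ENNReal.ofReal (Real.exp (-v x)))) :
    llr μ (gaussianReal 0 1) =ᵐ[μ] fun x => -v x - Real.log (gaussianPDFReal 0 1 x) := by
  have hm : Measurable (fun x => ENNReal.ofReal (Real.exp (-v x))) := by fun_prop
  have hac : μ ≪ volume := by rw [hμ]; exact withDensity_absolutelyContinuous _ _
  have h1 : μ.rnDeriv (gaussianReal 0 1) =ᵐ[volume]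
      fun x => (gaussianPDF 0 1 x)⁻¹ * μ.rnDeriv volume x := by
    rw [gaussianReal_of_var_ne_zero _ one_ne_zero]
    have : SigmaFinite μ := by
      rw [hμ]; exact SigmaFinite.withDensity_of_ne_top (ae_of_all _ fun _ => ENNReal.ofReal_ne_top)
    exact Measure.rnDeriv_withDensity_right _ _ (measurable_gaussianPDF 0 1).aemeasurable
      (ae_of_all _ fun x => (gaussianPDF_pos 0 one_ne_zero x).ne')
      (ae_of_all _ fun x => gaussianPDF_ne_top)
  have h2 : μ.rnDeriv volume =ᵐ[volume] fun x => ENNReal.ofReal (Real.exp (-v x)) := by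
    rw [hμ]; exact Measure.rnDeriv_withDensity _ hm
  filter_upwards [hac.ae_le h1, hac.ae_le h2] with x hx1 hx2
  have hφ := gaussianPDFReal_pos 0 1 x one_ne_zero
  rw [llr, hx1, hx2, ENNReal.toReal_mul, ENNReal.toReal_inv, toReal_gaussianPDF,
    ENNReal.toReal_ofReal (Real.exp_pos _).le, Real.log_mul (inv_ne_zero hφ.ne')
    (Real.exp_pos _).ne', Real.log_inv, Real.log_exp]
  ring

lemma log_gaussianPDFReal_zero_one_sub (x y : ℝ) :
    Real.log (gaussianPDFReal 0 1 x) - Real.log (gaussianPDFReal 0 1 y) =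
      (y ^ 2 - x ^ 2) / 2 := by
  have h : ∀ z : ℝ, Real.log (gaussianPDFReal 0 1 z) =
      Real.log (√(2 * Real.pi * (1 : NNReal)))⁻¹ + -z ^ 2 / 2 := fun z => by
    rw [gaussianPDFReal, Real.log_mul (by positivity) (Real.exp_pos _).ne', Real.log_exp]
    simp
  rw [h, h]
  ring

/-- Integrated form of the transport argument: the relative entropy, written along a Lipschitz
transport map `T` of derivative `T'`, controls the quadratic cost with an improved constant. -/
lemma mul_integral_sq_le_integral_of_deriv_le {T T' : ℝ → ℝ} (hT : ∀ x, HasDerivAt T (T' x) x)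
    (hT'c : Continuous T') (hT'0 : ∀ x, 0 < T' x) {r : ℝ} (hr : 0 < r) (hT'r : ∀ x, r * T' x ≤ 1)
    (hmean : ∫ x, T x ∂(gaussianReal 0 1) = 0)
    (hint : Integrable (fun x => (T x ^ 2 - x ^ 2) / 2 - Real.log (T' x)) (gaussianReal 0 1)) :
    Integrable (fun x => (T x - x) ^ 2) (gaussianReal 0 1) ∧
    (1 / 2 + (1 - Real.log 2) * min 1 r) * ∫ x, (T x - x) ^ 2 ∂(gaussianReal 0 1) ≤
      ∫ x, ((T x ^ 2 - x ^ 2) / 2 - Real.log (T' x)) ∂(gaussianReal 0 1) := by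
  have hTc : Continuous T := continuous_iff_continuousAt.2 fun x => (hT x).continuousAt
  set k : ℝ → ℝ := fun x => T x - x with hk
  have hkd : ∀ x, HasDerivAt k (T' x - 1) x := fun x => (hT x).sub (hasDerivAt_id x)
  have hkc : Continuous k := hTc.sub continuous_id
  set L := 1 / r + 1
  have hT'L : ∀ x, T' x ≤ 1 / r := fun x => by
    rw [le_div_iff₀ hr, mul_comm]; exact hT'r x
  have hkL : ∀ x, |T' x - 1| ≤ L := fun x => by
    have := hT'L x
    have := hT'0 x
    rw [abs_le]; constructor <;> linarith
  -- k is Lipschitz, so it grows at most linearly; Gaussian second moments then cover the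
  -- integrability of k, k² and xk.
  have hkb : ∀ x, |k x| ≤ |k 0| + L * |x| := fun x => by
    have h1 := abs_sub_le_mul_abs_of_abs_deriv_le hkd hkL x 0
    have h2 := abs_sub_abs_le_abs_sub (k x) (k 0)
    rw [sub_zero] at h1
    linarith
  have hk2b : ∀ x, k x ^ 2 ≤ 2 * |k 0| ^ 2 + 2 * L ^ 2 * x ^ 2 := fun x => by
    have h1 : k x ^ 2 ≤ (|k 0| + L * |x|) ^ 2 := by
      rw [← sq_abs (k x)]; exact pow_le_pow_left₀ (abs_nonneg _) (hkb x) 2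
    have h2 : x ^ 2 = |x| ^ 2 := (sq_abs x).symm
    rw [h2]
    nlinarith [sq_nonneg (|k 0| - L * |x|)]
  have i2 : Integrable (fun x => k x ^ 2) (gaussianReal 0 1) :=
    integrable_gaussianReal_of_abs_le (hkc.pow 2) _ _ fun x => by
      rw [abs_of_nonneg (sq_nonneg _)]; exact hk2b x
  have ix : Integrable (fun x : ℝ => x) (gaussianReal 0 1) :=
    integrable_gaussianReal_of_abs_le continuous_id 1 1 fun x => by
      rw [abs_le]; constructor <;> nlinarith [sq_nonneg (x + 1), sq_nonneg (x - 1)]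
  have i1 : Integrable k (gaussianReal 0 1) :=
    integrable_gaussianReal_of_abs_le hkc (1 + 2 * |k 0| ^ 2) (2 * L ^ 2) fun x => by
      have := hk2b x
      rw [abs_le]; constructor <;> nlinarith [sq_nonneg (k x + 1), sq_nonneg (k x - 1)]
  have ixk : Integrable (fun x => x * k x) (gaussianReal 0 1) :=
    integrable_gaussianReal_of_abs_le (continuous_id.mul hkc) (2 * |k 0| ^ 2) (2 * L ^ 2 + 1)
      fun x => by
        have := hk2b x
        rw [abs_le]
        constructor <;>
          nlinarith [sq_nonneg (k x + x), sq_nonneg (k x - x), sq_nonneg x, sq_nonneg (k x)]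
  have id1 : Integrable (fun x => T' x - 1) (gaussianReal 0 1) :=
    integrable_gaussianReal_of_abs_le (hT'c.sub continuous_const) L 0 fun x => by
      simpa using hkL x
  have id2 : Integrable (fun x => (T' x - 1) ^ 2) (gaussianReal 0 1) :=
    integrable_gaussianReal_of_abs_le ((hT'c.sub continuous_const).pow 2) (L ^ 2) 0 fun x => by
      rw [abs_of_nonneg (sq_nonneg _), zero_mul, add_zero, ← sq_abs]
      exact pow_le_pow_left₀ (abs_nonneg _) (hkL x) 2
  have hk0 : ∫ x, k x ∂(gaussianReal 0 1) = 0 := by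
    have iT : Integrable T (gaussianReal 0 1) := (i1.add ix).congr (ae_of_all _ fun x => by
      simp [hk])
    rw [hk, integral_sub iT ix, hmean, integral_id_gaussianReal, sub_zero]
  have hpoin := integral_sq_le_integral_deriv_sq_gaussianReal hkd
    (hT'c.sub continuous_const) hkL hk0 i1 i2
  have hstein := integral_deriv_sub_mul_gaussianReal hkd i1 (id1.sub ixk)
  -- T' − 1 − xk is subtracted because it integrates to zero by parts; what remains of the entropy
  -- is T' − 1 − log T'.
  have hle : ∀ x, 1 / 2 * k x ^ 2 - ((T' x - 1) - x * k x) +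
      (1 - Real.log 2) * min 1 r * (T' x - 1) ^ 2 ≤
      (T x ^ 2 - x ^ 2) / 2 - Real.log (T' x) := fun x => by
    have h1 := one_sub_log_two_mul_min_mul_sq_le (hT'0 x) (hT'r x)
    have h2 : (T x ^ 2 - x ^ 2) / 2 = 1 / 2 * k x ^ 2 + x * k x := by simp only [hk]; ring
    rw [h2]
    linarith
  have ia : Integrable (fun x => (T' x - 1) - x * k x) (gaussianReal 0 1) := id1.sub ixk
  have ib : Integrable (fun x => 1 / 2 * k x ^ 2 - ((T' x - 1) - x * k x)) (gaussianReal 0 1) :=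
    (i2.const_mul _).sub ia
  refine ⟨i2, ?_⟩
  have hmono := integral_mono (ib.add (id2.const_mul ((1 - Real.log 2) * min 1 r))) hint hle
  simp only [Pi.add_apply] at hmono
  rw [integral_add ib (id2.const_mul _), integral_sub (i2.const_mul _) ia, integral_const_mul,
    integral_const_mul, hstein, sub_zero] at hmono
  have hcm : 0 ≤ (1 - Real.log 2) * min 1 r :=
    mul_nonneg (by linarith [Real.log_two_lt_d9]) (le_min zero_le_one hr.le)
  have := mul_le_mul_of_nonneg_left hpoin hcm
  rw [add_mul]
  linarith

theorem theorem4p2 (μ : Measure ℝ) [IsProbabilityMeasure μ]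
    (v : ℝ → ℝ) (hv : ContDiff ℝ 2 v)
    (hμ : μ = volume.withDensity (fun x => ENNReal.ofReal (Real.exp (-v x))))
    (ε : ℝ) (hε : 0 < ε) (hconv : ∀ x : ℝ, ε ≤ deriv (deriv v) x)
    (hmean : ∫ x, x ∂μ = 0) :
    ENNReal.ofReal (1 / 2 + (1 - Real.log 2) * min 1 (Real.sqrt ε)) *
        W2 μ (gaussianReal 0 1) ^ 2 ≤
      klDiv μ (gaussianReal 0 1) := by
  -- Infinite entropy is trivial; finite entropy makes the log-likelihood ratio integrable.
  by_cases hfin : klDiv μ (gaussianReal 0 1) = ∞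
  · rw [hfin]; exact le_top
  obtain ⟨hac, hllr⟩ := klDiv_ne_top_iff.1 hfin
  have hvc : Continuous v := hv.continuous
  have hφ : ∀ x, 0 < gaussianPDFReal 0 1 x := fun x => gaussianPDFReal_pos 0 1 x one_ne_zero
  have hφc : Continuous (gaussianPDFReal 0 1) := continuous_iff_continuousAt.2 fun x =>
    (hasDerivAt_gaussianPDFReal_zero_one x).continuousAt
  obtain ⟨T, hT, hmap, htop, hbot⟩ := exists_monotone_transport
    (f := fun x => Real.exp (-v x)) (g := gaussianPDFReal 0 1) (ν := gaussianReal 0 1)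
    (by fun_prop) (fun x => Real.exp_pos _) hμ hφc hφ
    (gaussianReal_of_var_ne_zero 0 one_ne_zero)
  have hTc : Continuous T := continuous_iff_continuousAt.2 fun x => (hT x).continuousAt
  have hTm : AEMeasurable T (gaussianReal 0 1) := hTc.aemeasurable
  set T' : ℝ → ℝ := fun x => gaussianPDFReal 0 1 x / Real.exp (-v (T x)) with hT'
  have hT'0 : ∀ x, 0 < T' x := fun x => div_pos (hφ x) (Real.exp_pos _)
  have hT'c : Continuous T' := hφc.div (by fun_prop) fun x => (Real.exp_pos _).ne'
  have hT'r : ∀ x, √ε * T' x ≤ 1 := fun x => by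
    rw [hT', ← mul_div_assoc, div_le_one (Real.exp_pos _)]
    exact sqrt_mul_gaussianPDFReal_le hv hε hconv hT htop hbot x
  have hmeanT : ∫ x, T x ∂(gaussianReal 0 1) = 0 := by
    rwa [← hmap, integral_map hTm (by fun_prop)] at hmean
  have hllr_eq := llr_withDensity_gaussianReal hvc hμ
  -- The logarithm of the transport equation: −v(T x) = log φ(x) − log T'(x).
  have hpt : ∀ x, -v (T x) - Real.log (gaussianPDFReal 0 1 (T x)) =
      (T x ^ 2 - x ^ 2) / 2 - Real.log (T' x) := fun x => by
    have h1 := log_gaussianPDFReal_zero_one_sub x (T x)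
    rw [hT', Real.log_div (hφ x).ne' (Real.exp_pos _).ne', Real.log_exp]
    linarith
  have hasm : AEStronglyMeasurable (fun x => -v x - Real.log (gaussianPDFReal 0 1 x))
      ((gaussianReal 0 1).map T) :=
    (hvc.neg.sub (hφc.log fun x => (hφ x).ne')).aestronglyMeasurable
  have hint : Integrable (fun x => (T x ^ 2 - x ^ 2) / 2 - Real.log (T' x))
      (gaussianReal 0 1) := by
    have := hllr.congr hllr_eq
    rw [← hmap, integrable_map_measure hasm hTm] at this
    exact this.congr (ae_of_all _ hpt)
  have hval : ∫ x, llr μ (gaussianReal 0 1) x ∂μ =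
      ∫ x, ((T x ^ 2 - x ^ 2) / 2 - Real.log (T' x)) ∂(gaussianReal 0 1) := by
    rw [integral_congr_ae hllr_eq, ← integral_congr_ae (ae_of_all _ hpt)]
    conv_lhs => rw [← hmap]
    exact integral_map hTm hasm
  obtain ⟨hi, hmain⟩ := mul_integral_sq_le_integral_of_deriv_le hT hT'c hT'0
    (Real.sqrt_pos.2 hε) hT'r hmeanT hint
  have hW : W2 μ (gaussianReal 0 1) ^ 2 ≤
      ENNReal.ofReal (∫ x, (T x - x) ^ 2 ∂(gaussianReal 0 1)) := by
    refine (W2_sq_le_lintegral_of_map_eq hTc.measurable hmap).trans_eq ?_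
    rw [ofReal_integral_eq_lintegral_ofReal hi (ae_of_all _ fun x => sq_nonneg _)]
    refine lintegral_congr fun x => ?_
    rw [edist_dist, Real.dist_eq, ← ENNReal.ofReal_pow (abs_nonneg _), sq_abs]
  have hc : 0 ≤ 1 / 2 + (1 - Real.log 2) * min 1 (√ε) := by
    have := mul_nonneg (show 0 ≤ 1 - Real.log 2 by linarith [Real.log_two_lt_d9])
      (le_min zero_le_one (Real.sqrt_nonneg ε))
    linarith
  -- The mass correction in `klDiv` cancels for two probability measures.
  rw [klDiv_of_ac_of_integrable hac hllr, probReal_univ, probReal_univ, add_sub_cancel_right, hval]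
  calc _ ≤ ENNReal.ofReal (1 / 2 + (1 - Real.log 2) * min 1 (√ε)) *
        ENNReal.ofReal (∫ x, (T x - x) ^ 2 ∂(gaussianReal 0 1)) := by gcongr
    _ = ENNReal.ofReal ((1 / 2 + (1 - Real.log 2) * min 1 (√ε)) *
        ∫ x, (T x - x) ^ 2 ∂(gaussianReal 0 1)) := (ENNReal.ofReal_mul hc).symm
    _ ≤ _ := ENNReal.ofReal_le_ofReal hmain
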